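/- Let $\mathbb K$ be the field of real or complex numbers and let $p\in(0,1]$. A quasinorm on a $\mathbb K$-linear space $X$ is a function $\|\cdot\|:X\to[0,\infty)$ such that $\|x\|=0$ only if $x=0$, $\|\lambda x\|=|\lambda|\,\|x\|$, and $\|x+y\|\le C(\|x\|+\|y\|)$ for some constant $C$ and all $x,y\in X$, $\lambda\in\mathbb K$; the balls $\{x:\|x\|<\varepsilon\}$, $\varepsilon>0$, form a neighbourhood basis of $0$ for its linear topology. A $p$-Banach space is a linear space with a quasinorm that satisfies $\|x+y\|^p\le\|x\|^p+\|y\|^p$ for all $x,y$ and is complete for this topology. An isometry is a linear map $f$, not necessarily surjective, with $\|f(x)\|=\|x\|$ for all $x$. The density character of a topological space is the least cardinality of a dense subset. Theorem. There is a $p$-Banach space $U$ over $\mathbb K$ whose density character is the continuum $2^{\aleph_0}$ and which is of universal disposition for separable $p$-Banach spaces: whenever $Y$ is a separable $p$-Banach space over $\mathbb K$, $X$ is a linear subspace of $U$ and $g:X\to Y$ is an isometry, there is an isometry $f:Y\to U$ such that $f(g(x))=x$ for all $x\in X$. -/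

import Mathlib

open scoped Cardinal

universe w u v

/-- An additive group with a quasinorm: the part of the definition of a quasinormed space that does
not mention scalars. (`norm_zero'` and `norm_neg'` are consequences of homogeneity once scalars are
present; they are listed so that the topology can be defined without reference to the scalars.) -/
class QuasiNormedAddCommGroup (X : Type*) extends AddCommGroup X, Norm X where
  norm_nonneg' : ∀ x : X, 0 ≤ ‖x‖
  norm_zero' : ‖(0 : X)‖ = 0
  norm_neg' : ∀ x : X, ‖-x‖ = ‖x‖
  eq_zero_of_norm_eq_zero' : ∀ x : X, ‖x‖ = 0 → x = 0
  exists_norm_add_le' : ∃ C : ℝ, ∀ x y : X, ‖x + y‖ ≤ C * (‖x‖ + ‖y‖)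

/-- A quasinormed space over `𝕜` (the real or complex field). -/
class QuasiNormedSpace (𝕜 : Type*) [RCLike 𝕜] (X : Type*) [QuasiNormedAddCommGroup X]
    extends Module 𝕜 X where
  norm_smul' : ∀ (c : 𝕜) (x : X), ‖c • x‖ = ‖c‖ * ‖x‖

namespace QuasiNormedAddCommGroup

/-- The basic entourages `{(x, y) : ‖y - x‖ < ε}`, `ε > 0`, of the quasinorm uniformity. -/
def entourageBasis (X : Type*) [QuasiNormedAddCommGroup X] : FilterBasis (X × X) where
  sets := {V | ∃ ε : ℝ, 0 < ε ∧ V = {q : X × X | ‖q.2 - q.1‖ < ε}}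
  nonempty := ⟨_, 1, one_pos, rfl⟩
  inter_sets := by
    rintro _ _ ⟨ε, hε, rfl⟩ ⟨δ, hδ, rfl⟩
    exact ⟨_, ⟨min ε δ, lt_min hε hδ, rfl⟩, fun q hq => by
      have hq : ‖q.2 - q.1‖ < min ε δ := hq
      exact ⟨lt_of_lt_of_le hq (min_le_left _ _), lt_of_lt_of_le hq (min_le_right _ _)⟩⟩

/-- The quasinorm topology (with its uniformity): the balls `{x : ‖x‖ < ε}`, `ε > 0`, form a basis
of neighbourhoods of zero. It is the coarsest vector space topology for which the unit ball is a
neighbourhood of zero. -/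
instance toUniformSpace (X : Type*) [QuasiNormedAddCommGroup X] : UniformSpace X :=
  UniformSpace.ofCore <| UniformSpace.Core.mkOfBasis (entourageBasis X)
    (by
      rintro _ ⟨ε, hε, rfl⟩ x
      simpa [norm_zero'] using hε)
    (by
      rintro _ ⟨ε, hε, rfl⟩
      refine ⟨_, ⟨ε, hε, rfl⟩, fun q hq => ?_⟩
      have hq : ‖q.2 - q.1‖ < ε := hq
      have h := norm_neg' (q.2 - q.1)
      rw [neg_sub] at h
      simpa [h] using hq)
    (by
      rintro _ ⟨ε, hε, rfl⟩
      obtain ⟨C, hC⟩ := exists_norm_add_le' (X := X)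
      have hD : 0 < |C| + 1 := by positivity
      refine ⟨_, ⟨ε / (2 * (|C| + 1)), by positivity, rfl⟩, ?_⟩
      rintro ⟨x, z⟩ ⟨y, h₁, h₂⟩
      have h₁ : ‖y - x‖ < ε / (2 * (|C| + 1)) := h₁
      have h₂ : ‖z - y‖ < ε / (2 * (|C| + 1)) := h₂
      show ‖z - x‖ < ε
      have n₁ := norm_nonneg' (y - x)
      have n₂ := norm_nonneg' (z - y)
      calc ‖z - x‖ = ‖(z - y) + (y - x)‖ := by rw [sub_add_sub_cancel]
        _ ≤ C * (‖z - y‖ + ‖y - x‖) := hC _ _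
        _ ≤ (|C| + 1) * (‖z - y‖ + ‖y - x‖) := by
            gcongr
            linarith [le_abs_self C]
        _ < (|C| + 1) * (ε / (2 * (|C| + 1)) + ε / (2 * (|C| + 1))) := by gcongr
        _ = ε := by field_simp; norm_num)

end QuasiNormedAddCommGroup

/-- A `p`-Banach space: a quasinormed space, complete for the quasinorm topology, whose quasinorm is
a `p`-norm. -/
structure IsPBanachSpace (p : ℝ) (𝕜 : Type*) [RCLike 𝕜] (X : Type*) [QuasiNormedAddCommGroup X]
    [QuasiNormedSpace 𝕜 X] : Prop where
  norm_add_rpow_le : ∀ x y : X, ‖x + y‖ ^ p ≤ ‖x‖ ^ p + ‖y‖ ^ p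
  complete : CompleteSpace X

/-- The density character of a topological space: the least cardinality of a dense subset. -/
noncomputable def densityCharacter (X : Type*) [TopologicalSpace X] : Cardinal :=
  sInf {κ | ∃ s : Set X, Dense s ∧ #s = κ}

/-- `U` is of universal disposition for the class `𝒞`: every (linear, not necessarily surjective)
isometry `g : X → Y` from a linear subspace `X` of `U` into a member `Y` of `𝒞` admits an isometry
`f : Y → U` with `f (g x) = x` for all `x ∈ X`. -/
def IsOfUniversalDisposition (𝕜 : Type w) [RCLike 𝕜] (U : Type u)
    [QuasiNormedAddCommGroup U] [QuasiNormedSpace 𝕜 U]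
    (𝒞 : ∀ (Y : Type v) [QuasiNormedAddCommGroup Y] [QuasiNormedSpace 𝕜 Y], Prop) : Prop :=
  ∀ (Y : Type v) [QuasiNormedAddCommGroup Y] [QuasiNormedSpace 𝕜 Y], 𝒞 Y →
    ∀ (X : Submodule 𝕜 U) (g : X →ₗ[𝕜] Y), (∀ x : X, ‖g x‖ = ‖(x : U)‖) →
      ∃ f : Y →ₗ[𝕜] U, (∀ y : Y, ‖f y‖ = ‖y‖) ∧ ∀ x : X, f (g x) = (x : U)

/-! Working with the `p`-th power of a `p`-norm makes the triangle inequality additive, so the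
amalgamation of spaces can be done by infima of sums of costs.

Instead of iterating push-outs, one takes the free space on generators indexed by `I × ℕ`, with `I`
well-ordered in the initial order type of the continuum. Each `i : I` carries an extension problem
about vectors below `i`, and its `ℕ` generators are to be the solution. A vector gets the least
total cost of a decomposition into pieces, each measured by its own problem. Eliminating the largest
index by well-founded induction (`gauge_assemble_le`) shows that later problems do not change
earlier values; hence each prescribed seminorm is realised exactly (`gauge_pieceMap`).

A `p`-seminorm on a space of countable dimension is determined by countably many values, so there
are at most continuum many problems, and each can be listed cofinally often. A countable set in `I`
is bounded, so every problem is met after its data have appeared.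

Solvability of these problems passes to the quotient by the null space and yields both completeness
(a limit is a solution of a problem) and universal disposition (prescribe the norm on dense
sequences, then extend by density). A problem repeated continuum many times gives a separated set,
which bounds the density character from below; cardinality bounds it from above. -/

/-- The `p`-th power of a `p`-seminorm: a subadditive, absolutely `p`-homogeneous function. -/
structure IsPSeminorm (𝕜 : Type*) [RCLike 𝕜] (p : ℝ) {E : Type*} [AddCommGroup E] [Module 𝕜 E]
    (N : E → ℝ) : Prop where
  nonneg : ∀ x, 0 ≤ N x
  add_le : ∀ x y, N (x + y) ≤ N x + N y
  smul : ∀ (c : 𝕜) (x : E), N (c • x) = ‖c‖ ^ p * N x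

namespace IsPSeminorm

variable {𝕜 : Type*} [RCLike 𝕜] {p : ℝ} {E F : Type*} [AddCommGroup E] [Module 𝕜 E]
  [AddCommGroup F] [Module 𝕜 F] {N : E → ℝ}

theorem map_zero (hN : IsPSeminorm 𝕜 p N) (hp : 0 < p) : N 0 = 0 := by
  have h := hN.smul 0 0
  rwa [smul_zero, norm_zero, Real.zero_rpow hp.ne', zero_mul] at h

theorem map_neg (hN : IsPSeminorm 𝕜 p N) (x : E) : N (-x) = N x := by
  have h := hN.smul (-1) x
  simpa using h

theorem map_sub_rev (hN : IsPSeminorm 𝕜 p N) (x y : E) : N (x - y) = N (y - x) := by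
  rw [← neg_sub, hN.map_neg]

theorem sub_le_add (hN : IsPSeminorm 𝕜 p N) (x y z : E) : N (x - z) ≤ N (x - y) + N (y - z) := by
  simpa using hN.add_le (x - y) (y - z)

theorem abs_sub_le (hN : IsPSeminorm 𝕜 p N) (x y : E) : |N x - N y| ≤ N (x - y) := by
  rw [abs_le]
  have h₁ := hN.add_le (x - y) y
  have h₂ := hN.add_le (y - x) x
  rw [sub_add_cancel] at h₁ h₂
  rw [hN.map_sub_rev y x] at h₂
  constructor <;> linarith

theorem comp (hN : IsPSeminorm 𝕜 p N) (f : F →ₗ[𝕜] E) : IsPSeminorm 𝕜 p (fun x => N (f x)) where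
  nonneg _ := hN.nonneg _
  add_le x y := by simpa using hN.add_le (f x) (f y)
  smul c x := by simpa using hN.smul c (f x)

theorem zero : IsPSeminorm 𝕜 p (fun _ : E => (0 : ℝ)) :=
  ⟨fun _ => le_rfl, fun _ _ => by simp, fun _ _ => by simp⟩

end IsPSeminorm

/-- An extension problem in `V`: a sequence in `V` together with (the `p`-th power of) a
`p`-seminorm on a space spanned by that sequence and a further sequence to be found. -/
@[ext]
structure ExtensionProblem (𝕜 : Type*) [RCLike 𝕜] (p : ℝ) (V : Type*) where
  x : ℕ → V
  M : (ℕ →₀ 𝕜) × (ℕ →₀ 𝕜) → ℝ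
  isPSeminorm : IsPSeminorm 𝕜 p M

/-- Every extension problem posed in `V` has a solution in `V`. -/
def SolvesExtensionProblems (𝕜 : Type*) [RCLike 𝕜] (p : ℝ) {V : Type*} [AddCommGroup V]
    [Module 𝕜 V] (N : V → ℝ) : Prop :=
  ∀ (x : ℕ → V) (M : (ℕ →₀ 𝕜) × (ℕ →₀ 𝕜) → ℝ), IsPSeminorm 𝕜 p M →
    (∀ a, N (Finsupp.linearCombination 𝕜 x a) = M (a, 0)) →
    ∃ y : ℕ → V, ∀ c, N (Finsupp.linearCombination 𝕜 x c.1 +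
      Finsupp.linearCombination 𝕜 y c.2) = M c

/-! ### Amalgamating extension problems along a well-order -/

namespace Amalgam

open Finsupp Set

variable {𝕜 : Type*} [RCLike 𝕜] {p : ℝ} {I : Type*}

/-- The map sending a pair of coefficient sequences to the combination of the given sequence of the
problem `P` and the new generators of index `j`. -/
noncomputable def pieceMap (P : ExtensionProblem 𝕜 p (I →₀ (ℕ →₀ 𝕜))) (j : I) :
    (ℕ →₀ 𝕜) × (ℕ →₀ 𝕜) →ₗ[𝕜] (I →₀ (ℕ →₀ 𝕜)) :=
  (Finsupp.linearCombination 𝕜 P.x).coprod (Finsupp.lsingle j)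

theorem pieceMap_apply (P : ExtensionProblem 𝕜 p (I →₀ (ℕ →₀ 𝕜))) (j : I)
    (c : (ℕ →₀ 𝕜) × (ℕ →₀ 𝕜)) :
    pieceMap P j c = Finsupp.linearCombination 𝕜 P.x c.1 + single j c.2 := rfl

/-- The sum of the pieces of a finite decomposition. -/
noncomputable def assemble (prob : I → ExtensionProblem 𝕜 p (I →₀ (ℕ →₀ 𝕜))) :
    (I →₀ ((ℕ →₀ 𝕜) × (ℕ →₀ 𝕜))) →ₗ[𝕜] (I →₀ (ℕ →₀ 𝕜)) :=
  Finsupp.lsum ℕ fun j => pieceMap (prob j) j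

/-- The cost of a finite decomposition. -/
noncomputable def cost (prob : I → ExtensionProblem 𝕜 p (I →₀ (ℕ →₀ 𝕜)))
    (w : I →₀ ((ℕ →₀ 𝕜) × (ℕ →₀ 𝕜))) : ℝ :=
  w.sum fun j c => (prob j).M c

/-- The infimum of the costs of the decompositions of `v` into pieces with indices in `S`. -/
noncomputable def gauge (prob : I → ExtensionProblem 𝕜 p (I →₀ (ℕ →₀ 𝕜))) (S : Set I)
    (v : I →₀ (ℕ →₀ 𝕜)) : ℝ :=
  sInf (cost prob '' {w | w ∈ supported ((ℕ →₀ 𝕜) × (ℕ →₀ 𝕜)) 𝕜 S ∧ assemble prob w = v})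

variable {prob : I → ExtensionProblem 𝕜 p (I →₀ (ℕ →₀ 𝕜))}

theorem assemble_single (j : I) (c : (ℕ →₀ 𝕜) × (ℕ →₀ 𝕜)) :
    assemble prob (single j c) = pieceMap (prob j) j c := by
  simp [assemble]

theorem cost_single (hp : 0 < p) (j : I) (c : (ℕ →₀ 𝕜) × (ℕ →₀ 𝕜)) :
    cost prob (single j c) = (prob j).M c := by
  simp [cost, (prob j).isPSeminorm.map_zero hp]

theorem isPSeminorm_cost (hp : 0 < p) : IsPSeminorm 𝕜 p (cost prob) where
  nonneg w := Finset.sum_nonneg fun j _ => (prob j).isPSeminorm.nonneg _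
  add_le w w' := by
    classical
    have h0 : ∀ j, (prob j).M 0 = 0 := fun j => (prob j).isPSeminorm.map_zero hp
    rw [cost, cost, cost, Finsupp.sum_of_support_subset (w + w') Finsupp.support_add _ (by simp [h0]),
      Finsupp.sum_of_support_subset w (Finset.subset_union_left (s₂ := w'.support)) _ (by simp [h0]),
      Finsupp.sum_of_support_subset w' (Finset.subset_union_right (s₁ := w.support)) _
        (by simp [h0]), ← Finset.sum_add_distrib]
    exact Finset.sum_le_sum fun j _ => (prob j).isPSeminorm.add_le _ _
  smul c w := by
    have h0 : ∀ j, (prob j).M 0 = 0 := fun j => (prob j).isPSeminorm.map_zero hp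
    rw [cost, cost, Finsupp.sum_of_support_subset (c • w) Finsupp.support_smul _ (by simp [h0]),
      Finsupp.sum, Finset.mul_sum]
    exact Finset.sum_congr rfl fun j _ => (prob j).isPSeminorm.smul _ _

theorem cost_eq_add_erase (hp : 0 < p) (w : I →₀ ((ℕ →₀ 𝕜) × (ℕ →₀ 𝕜))) (j : I) :
    cost prob w = (prob j).M (w j) + cost prob (w.erase j) :=
  (Finsupp.add_sum_erase' w j _ fun k => (prob k).isPSeminorm.map_zero hp).symm

theorem assemble_eq_add_erase (w : I →₀ ((ℕ →₀ 𝕜) × (ℕ →₀ 𝕜))) (j : I) :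
    assemble prob w = pieceMap (prob j) j (w j) + assemble prob (w.erase j) := by
  conv_lhs => rw [← Finsupp.single_add_erase j w]
  rw [map_add, assemble_single]

theorem bddBelow_cost (hp : 0 < p) (T : Set (I →₀ ((ℕ →₀ 𝕜) × (ℕ →₀ 𝕜)))) :
    BddBelow (cost prob '' T) :=
  ⟨0, by rintro _ ⟨w, -, rfl⟩; exact (isPSeminorm_cost hp).nonneg w⟩

theorem gauge_le (hp : 0 < p) {S : Set I} {w : I →₀ ((ℕ →₀ 𝕜) × (ℕ →₀ 𝕜))}
    (hw : w ∈ supported ((ℕ →₀ 𝕜) × (ℕ →₀ 𝕜)) 𝕜 S) :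
    gauge prob S (assemble prob w) ≤ cost prob w :=
  csInf_le (bddBelow_cost hp _) ⟨w, ⟨hw, rfl⟩, rfl⟩

theorem gauge_nonneg (hp : 0 < p) (S : Set I) (v : I →₀ (ℕ →₀ 𝕜)) : 0 ≤ gauge prob S v :=
  Real.sInf_nonneg (by rintro _ ⟨w, -, rfl⟩; exact (isPSeminorm_cost hp).nonneg w)

theorem gauge_zero (hp : 0 < p) (S : Set I) : gauge prob S 0 = 0 := by
  refine le_antisymm ?_ (gauge_nonneg hp _ _)
  have h := gauge_le (prob := prob) hp (Submodule.zero_mem (supported _ 𝕜 S))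
  rwa [_root_.map_zero, (isPSeminorm_cost hp).map_zero hp] at h

theorem decomposition_nonempty {S : Set I} {v : I →₀ (ℕ →₀ 𝕜)}
    (hv : v ∈ supported (ℕ →₀ 𝕜) 𝕜 S) :
    {w | w ∈ supported ((ℕ →₀ 𝕜) × (ℕ →₀ 𝕜)) 𝕜 S ∧ assemble prob w = v}.Nonempty := by
  -- Using only new generators, with zero first components, always gives a decomposition; so the
  -- infimum is never the default value `sInf ∅ = 0`.
  refine ⟨v.mapRange (fun b => ((0 : ℕ →₀ 𝕜), b)) rfl, ?_, ?_⟩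
  · rw [mem_supported] at hv ⊢
    exact (Finset.coe_subset.2 Finsupp.support_mapRange).trans hv
  · rw [assemble, Finsupp.lsum_apply, Finsupp.sum_mapRange_index (by simp)]
    simp [pieceMap_apply]

theorem exists_cost_lt {S : Set I} {v : I →₀ (ℕ →₀ 𝕜)}
    (hv : v ∈ supported (ℕ →₀ 𝕜) 𝕜 S) {r : ℝ} (hr : gauge prob S v < r) :
    ∃ w ∈ supported ((ℕ →₀ 𝕜) × (ℕ →₀ 𝕜)) 𝕜 S, assemble prob w = v ∧ cost prob w < r := by
  obtain ⟨_, ⟨w, ⟨h₁, h₂⟩, rfl⟩, h₃⟩ :=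
    exists_lt_of_csInf_lt ((decomposition_nonempty (prob := prob) hv).image _) hr
  exact ⟨w, h₁, h₂, h₃⟩

theorem le_gauge {S : Set I} {v : I →₀ (ℕ →₀ 𝕜)} (hv : v ∈ supported (ℕ →₀ 𝕜) 𝕜 S) {r : ℝ}
    (h : ∀ w ∈ supported ((ℕ →₀ 𝕜) × (ℕ →₀ 𝕜)) 𝕜 S, assemble prob w = v → r ≤ cost prob w) :
    r ≤ gauge prob S v :=
  le_csInf ((decomposition_nonempty (prob := prob) hv).image _)
    (by rintro _ ⟨w, ⟨h₁, h₂⟩, rfl⟩; exact h w h₁ h₂)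

theorem isPSeminorm_gauge (hp : 0 < p) : IsPSeminorm 𝕜 p (gauge prob univ) := by
  have hmem : ∀ v : I →₀ (ℕ →₀ 𝕜), v ∈ supported (ℕ →₀ 𝕜) 𝕜 univ := fun v => by simp
  have hsmul : ∀ (c : 𝕜) v, gauge prob univ (c • v) ≤ ‖c‖ ^ p * gauge prob univ v := by
    intro c v
    rcases eq_or_ne c 0 with rfl | hc
    · simp [gauge_zero hp, Real.zero_rpow hp.ne']
    · have hc' : 0 < ‖c‖ ^ p := Real.rpow_pos_of_pos (norm_pos_iff.2 hc) _
      rw [← div_le_iff₀' hc']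
      refine le_gauge (hmem v) fun w hw hwv => ?_
      rw [div_le_iff₀' hc', ← (isPSeminorm_cost hp).smul, ← hwv, ← map_smul]
      exact gauge_le hp (Submodule.smul_mem _ _ hw)
  refine ⟨gauge_nonneg hp _, fun v v' => ?_, fun c v => le_antisymm (hsmul c v) ?_⟩
  · refine le_of_forall_pos_lt_add fun ε hε => ?_
    obtain ⟨w, hw, rfl, h⟩ := exists_cost_lt (prob := prob) (hmem v) (lt_add_of_pos_right _ (half_pos hε))
    obtain ⟨w', hw', rfl, h'⟩ := exists_cost_lt (prob := prob) (hmem v') (lt_add_of_pos_right _ (half_pos hε))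
    rw [← map_add]
    have h₁ := gauge_le (prob := prob) hp (Submodule.add_mem _ hw hw')
    have h₂ := (isPSeminorm_cost (prob := prob) hp).add_le w w'
    linarith
  · rcases eq_or_ne c 0 with rfl | hc
    · simp [gauge_zero hp, Real.zero_rpow hp.ne']
    · have hc' : 0 < ‖c‖ ^ p := Real.rpow_pos_of_pos (norm_pos_iff.2 hc) _
      have h := hsmul c⁻¹ (c • v)
      rw [inv_smul_smul₀ hc, norm_inv, Real.inv_rpow (norm_nonneg _), ← div_eq_inv_mul,
        le_div_iff₀' hc'] at h
      exact h

theorem assemble_congr {prob' : I → ExtensionProblem 𝕜 p (I →₀ (ℕ →₀ 𝕜))} {S : Set I}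
    (h : ∀ j ∈ S, prob j = prob' j) {w : I →₀ ((ℕ →₀ 𝕜) × (ℕ →₀ 𝕜))}
    (hw : w ∈ supported ((ℕ →₀ 𝕜) × (ℕ →₀ 𝕜)) 𝕜 S) : assemble prob w = assemble prob' w := by
  simp only [assemble, lsum_apply]
  exact Finsupp.sum_congr fun j hj => by rw [h j ((mem_supported _ _).1 hw hj)]

theorem cost_congr {prob' : I → ExtensionProblem 𝕜 p (I →₀ (ℕ →₀ 𝕜))} {S : Set I}
    (h : ∀ j ∈ S, prob j = prob' j) {w : I →₀ ((ℕ →₀ 𝕜) × (ℕ →₀ 𝕜))}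
    (hw : w ∈ supported ((ℕ →₀ 𝕜) × (ℕ →₀ 𝕜)) 𝕜 S) : cost prob w = cost prob' w :=
  Finsupp.sum_congr fun j hj => by rw [h j ((mem_supported _ _).1 hw hj)]

/-- This locality makes the recursion well-posed: whether a problem is admissible at `i` depends
only on the problems chosen before `i`. -/
theorem gauge_congr {prob' : I → ExtensionProblem 𝕜 p (I →₀ (ℕ →₀ 𝕜))} {S : Set I}
    (h : ∀ j ∈ S, prob j = prob' j) (v : I →₀ (ℕ →₀ 𝕜)) : gauge prob S v = gauge prob' S v := by
  rw [gauge, gauge]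
  refine congrArg sInf (Set.ext fun r => ⟨?_, ?_⟩)
  · rintro ⟨w, ⟨hw, rfl⟩, rfl⟩
    exact ⟨w, ⟨hw, (assemble_congr h hw).symm⟩, (cost_congr h hw).symm⟩
  · rintro ⟨w, ⟨hw, rfl⟩, rfl⟩
    exact ⟨w, ⟨hw, assemble_congr h hw⟩, cost_congr h hw⟩

section Order

variable [LinearOrder I]

/-- The problem `P` lives on the generators of index below `i`, and its seminorm agrees there with
the gauge of the problems handled before `i`. -/
def Consistent (prob : I → ExtensionProblem 𝕜 p (I →₀ (ℕ →₀ 𝕜))) (i : I)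
    (P : ExtensionProblem 𝕜 p (I →₀ (ℕ →₀ 𝕜))) : Prop :=
  (∀ n, P.x n ∈ supported (ℕ →₀ 𝕜) 𝕜 (Iio i)) ∧
    ∀ a : ℕ →₀ 𝕜, gauge prob (Iio i) (Finsupp.linearCombination 𝕜 P.x a) = P.M (a, 0)

theorem Consistent.linearCombination_mem {i : I} {P : ExtensionProblem 𝕜 p (I →₀ (ℕ →₀ 𝕜))}
    (h : Consistent prob i P) (a : ℕ →₀ 𝕜) :
    Finsupp.linearCombination 𝕜 P.x a ∈ supported (ℕ →₀ 𝕜) 𝕜 (Iio i) :=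
  Submodule.sum_mem _ fun n _ => Submodule.smul_mem _ _ (h.1 n)

/-- Well-founded recursion: the proposed problem `e i` is accepted if it is consistent with the
earlier choices, and is otherwise replaced by the zero problem, which is always consistent. -/
theorem exists_consistent [WellFoundedLT I] (hp : 0 < p)
    (e : I → ExtensionProblem 𝕜 p (I →₀ (ℕ →₀ 𝕜))) :
    ∃ prob : I → ExtensionProblem 𝕜 p (I →₀ (ℕ →₀ 𝕜)), (∀ i, Consistent prob i (prob i)) ∧
      ∀ i, Consistent prob i (e i) → prob i = e i := by
  classical
  let P₀ : ExtensionProblem 𝕜 p (I →₀ (ℕ →₀ 𝕜)) := ⟨0, fun _ => 0, .zero⟩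
  let ext (i : I) (r : ∀ j, j < i → ExtensionProblem 𝕜 p (I →₀ (ℕ →₀ 𝕜))) (j : I) :=
    if h : j < i then r j h else P₀
  let F (i : I) (r : ∀ j, j < i → ExtensionProblem 𝕜 p (I →₀ (ℕ →₀ 𝕜))) :=
    if Consistent (ext i r) i (e i) then e i else P₀
  let prob : I → ExtensionProblem 𝕜 p (I →₀ (ℕ →₀ 𝕜)) := (wellFounded_lt (α := I)).fix F
  have hext : ∀ i P, Consistent (ext i fun j _ => prob j) i P ↔ Consistent prob i P := by
    intro i P
    have h : ∀ v, gauge (ext i fun j _ => prob j) (Iio i) v = gauge prob (Iio i) v :=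
      gauge_congr fun j hj => dif_pos (mem_Iio.1 hj)
    simp only [Consistent, h]
  have hprob : ∀ i, prob i = if Consistent prob i (e i) then e i else P₀ := by
    intro i
    have h : prob i = F i fun j _ => prob j := (wellFounded_lt (α := I)).fix_eq F i
    rw [h]
    simp only [F, hext]
  refine ⟨prob, fun i => ?_, fun i hi => by rw [hprob, if_pos hi]⟩
  rw [hprob i]
  split_ifs with h
  · exact h
  · refine ⟨fun n => Submodule.zero_mem _, fun a => ?_⟩
    simp [P₀, gauge_zero hp]

theorem exists_mem_supported_Iic {w : I →₀ ((ℕ →₀ 𝕜) × (ℕ →₀ 𝕜))} (hw : w ≠ 0) :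
    ∃ j ∈ w.support, w ∈ supported ((ℕ →₀ 𝕜) × (ℕ →₀ 𝕜)) 𝕜 (Iic j) := by
  have hne := Finsupp.support_nonempty_iff.2 hw
  exact ⟨_, w.support.max'_mem hne, (mem_supported _ _).2 fun k hk => w.support.le_max' _ hk⟩

theorem erase_mem_supported {w : I →₀ ((ℕ →₀ 𝕜) × (ℕ →₀ 𝕜))} {j : I}
    (hw : w ∈ supported ((ℕ →₀ 𝕜) × (ℕ →₀ 𝕜)) 𝕜 (Iic j)) :
    w.erase j ∈ supported ((ℕ →₀ 𝕜) × (ℕ →₀ 𝕜)) 𝕜 (Iio j) := by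
  rw [mem_supported] at hw ⊢
  intro k hk
  rw [Finset.mem_coe, Finsupp.support_erase, Finset.mem_erase] at hk
  exact lt_of_le_of_ne (hw hk.2) hk.1

variable (hcons : ∀ i, Consistent prob i (prob i))
include hcons

theorem assemble_mem_supported {S : Set I} (hS : IsLowerSet S)
    {w : I →₀ ((ℕ →₀ 𝕜) × (ℕ →₀ 𝕜))} (hw : w ∈ supported ((ℕ →₀ 𝕜) × (ℕ →₀ 𝕜)) 𝕜 S) :
    assemble prob w ∈ supported (ℕ →₀ 𝕜) 𝕜 S := by
  rw [assemble, lsum_apply]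
  refine Submodule.sum_mem _ fun j hj => ?_
  have hjS : j ∈ S := (mem_supported _ _).1 hw hj
  refine Submodule.add_mem _ ?_ (Finsupp.single_mem_supported _ _ hjS)
  exact Finsupp.supported_mono (fun k hk => hS (le_of_lt hk) hjS)
    ((hcons j).linearCombination_mem _)

/-- Every other piece, and the old part of the piece at `j`, lives strictly below `j`. -/
theorem assemble_apply_of_mem_supported_Iic {j : I} {w : I →₀ ((ℕ →₀ 𝕜) × (ℕ →₀ 𝕜))}
    (hw : w ∈ supported ((ℕ →₀ 𝕜) × (ℕ →₀ 𝕜)) 𝕜 (Iic j)) : assemble prob w j = (w j).2 := by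
  have h : ∀ v ∈ supported (ℕ →₀ 𝕜) 𝕜 (Iio j), v j = 0 := fun v hv =>
    Finsupp.notMem_support_iff.1 fun hj => lt_irrefl j ((mem_supported _ _).1 hv hj)
  rw [assemble_eq_add_erase w j, pieceMap_apply, Finsupp.add_apply, Finsupp.add_apply,
    h _ ((hcons j).linearCombination_mem _),
    h _ (assemble_mem_supported hcons (isLowerSet_Iio j) (erase_mem_supported hw))]
  simp

variable [WellFoundedLT I]

/-- Indices outside `S` can be eliminated from the top. If the largest index `j` is not in `S`, the
new component of its piece vanishes, so that piece is a vector below `j` whose cost is, by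
consistency, its gauge over `Iio j`. Up to `ε` it can be redecomposed below `j` at the same cost,
and the largest index drops. -/
theorem gauge_assemble_le (hp : 0 < p) {S : Set I} (hS : IsLowerSet S)
    {w : I →₀ ((ℕ →₀ 𝕜) × (ℕ →₀ 𝕜))} (hw : assemble prob w ∈ supported (ℕ →₀ 𝕜) 𝕜 S) :
    gauge prob S (assemble prob w) ≤ cost prob w := by
  have key : ∀ j, ∀ w ∈ supported ((ℕ →₀ 𝕜) × (ℕ →₀ 𝕜)) 𝕜 (Iic j),
      assemble prob w ∈ supported (ℕ →₀ 𝕜) 𝕜 S →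
        gauge prob S (assemble prob w) ≤ cost prob w := by
    intro j
    induction j using WellFoundedLT.induction with
    | ind j ih =>
    intro w hw hwS
    by_cases hj : j ∈ S
    · exact gauge_le hp (Finsupp.supported_mono (fun k hk => hS hk hj) hw)
    have hj0 : (w j).2 = 0 := by
      rw [← assemble_apply_of_mem_supported_Iic hcons hw]
      exact Finsupp.notMem_support_iff.1 fun h => hj ((mem_supported _ _).1 hwS h)
    have hwj : w j = ((w j).1, 0) := Prod.ext rfl hj0
    refine le_of_forall_pos_lt_add fun ε hε => ?_
    obtain ⟨w', hw', hass, hcost⟩ := exists_cost_lt (prob := prob)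
      ((hcons j).linearCombination_mem (w j).1) (lt_add_of_pos_right _ hε)
    rw [(hcons j).2, ← hwj] at hcost
    have heq : assemble prob (w.erase j + w') = assemble prob w := by
      rw [map_add, hass, assemble_eq_add_erase w j, pieceMap_apply, hj0, Finsupp.single_zero,
        add_zero, add_comm]
    have hmem := Submodule.add_mem _ (erase_mem_supported hw) hw'
    have hle : gauge prob S (assemble prob w) ≤ cost prob (w.erase j + w') := by
      rw [← heq] at hwS ⊢
      by_cases h0 : w.erase j + w' = 0
      · rw [h0]
        exact gauge_le hp (Submodule.zero_mem _)
      · obtain ⟨k, hk, hk'⟩ := exists_mem_supported_Iic h0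
        exact ih k ((mem_supported _ _).1 hmem hk) _ hk' hwS
    have h₁ := (isPSeminorm_cost (prob := prob) hp).add_le (w.erase j) w'
    have h₂ := cost_eq_add_erase (prob := prob) hp w j
    linarith
  by_cases h0 : w = 0
  · rw [h0]
    exact gauge_le hp (Submodule.zero_mem _)
  · obtain ⟨k, -, hk'⟩ := exists_mem_supported_Iic h0
    exact key k w hk' hw

theorem gauge_eq_gauge_univ (hp : 0 < p) {S : Set I} (hS : IsLowerSet S) {v : I →₀ (ℕ →₀ 𝕜)}
    (hv : v ∈ supported (ℕ →₀ 𝕜) 𝕜 S) : gauge prob S v = gauge prob univ v := by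
  refine le_antisymm (le_gauge (by simp) ?_) (le_gauge hv ?_)
  · rintro w - rfl
    exact gauge_assemble_le hcons hp hS hv
  · rintro w - rfl
    exact gauge_le hp (by simp)

/-- Lower bounds need only be tested on decompositions ending at `j`, where the new component at `j`
is forced. -/
theorem le_gauge_univ_of_mem_Iic (hp : 0 < p) {j : I} {v : I →₀ (ℕ →₀ 𝕜)}
    (hv : v ∈ supported (ℕ →₀ 𝕜) 𝕜 (Iic j)) {r : ℝ}
    (h : ∀ w ∈ supported ((ℕ →₀ 𝕜) × (ℕ →₀ 𝕜)) 𝕜 (Iic j), assemble prob w = v →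
      (w j).2 = v j → r ≤ cost prob w) : r ≤ gauge prob univ v := by
  rw [← gauge_eq_gauge_univ hcons hp (isLowerSet_Iic j) hv]
  refine le_gauge hv fun w hw hwv => h w hw hwv ?_
  rw [← hwv, assemble_apply_of_mem_supported_Iic hcons hw]

/-- The single piece gives `≤`. Conversely, a decomposition `w` ending at `j` has the new component
`c.2` there, so its remaining pieces assemble to the combination with coefficients `c.1 - (w j).1`.
By consistency they cost at least `M` of that difference, and the triangle inequality for `M`
concludes. -/
theorem gauge_pieceMap (hp : 0 < p) (j : I) (c : (ℕ →₀ 𝕜) × (ℕ →₀ 𝕜)) :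
    gauge prob univ (pieceMap (prob j) j c) = (prob j).M c := by
  have hlc : ∀ a, Finsupp.linearCombination 𝕜 (prob j).x a ∈ supported (ℕ →₀ 𝕜) 𝕜 (Iio j) :=
    (hcons j).linearCombination_mem
  refine le_antisymm ?_ (le_gauge_univ_of_mem_Iic hcons hp (j := j) ?_ fun w hw hwv hwj => ?_)
  · rw [← assemble_single, ← cost_single hp]
    exact gauge_le hp (by simp)
  · rw [← assemble_single]
    exact assemble_mem_supported hcons (isLowerSet_Iic j)
      (Finsupp.single_mem_supported _ _ (mem_Iic.2 le_rfl))
  · have hj : (w j).2 = c.2 := by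
      have h0 : Finsupp.linearCombination 𝕜 (prob j).x c.1 j = 0 :=
        Finsupp.notMem_support_iff.1 fun h => lt_irrefl j ((mem_supported _ _).1 (hlc c.1) h)
      rw [hwj, pieceMap_apply, Finsupp.add_apply, h0]
      simp
    have hc : c = w j + (c.1 - (w j).1, 0) := by
      ext : 1 <;> simp [hj]
    have hass : assemble prob (w.erase j) =
        Finsupp.linearCombination 𝕜 (prob j).x (c.1 - (w j).1) := by
      rw [assemble_eq_add_erase w j, pieceMap_apply, pieceMap_apply, hj] at hwv
      rw [map_sub, sub_eq_of_eq_add]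
      rw [← add_right_cancel_iff (a := single j c.2), ← hwv]
      abel
    have h₁ : (prob j).M (c.1 - (w j).1, 0) ≤ cost prob (w.erase j) := by
      rw [← (hcons j).2, ← hass]
      exact gauge_le hp (erase_mem_supported hw)
    have h₂ := (prob j).isPSeminorm.add_le (w j) (c.1 - (w j).1, 0)
    rw [← hc] at h₂
    rw [cost_eq_add_erase hp w j]
    linarith

/-- Any decomposition of the difference must pay `M (a, b)` for some `a` at index `j`. This supplies
the separated set. -/
theorem le_gauge_single_sub (hp : 0 < p) {j : I} {b : ℕ →₀ 𝕜} {r : ℝ}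
    (hr : ∀ a, r ≤ (prob j).M (a, b)) {v : I →₀ (ℕ →₀ 𝕜)}
    (hv : v ∈ supported (ℕ →₀ 𝕜) 𝕜 (Iio j)) : r ≤ gauge prob univ (single j b - v) := by
  refine le_gauge_univ_of_mem_Iic hcons hp (j := j) ?_ fun w _ _ hwj => ?_
  · have h₁ : single j b ∈ supported (ℕ →₀ 𝕜) 𝕜 (Iic j) :=
      Finsupp.single_mem_supported _ _ (mem_Iic.2 le_rfl)
    have h₂ : single j b - v = single j b + (-1 : 𝕜) • v := by
      ext k n
      simp [sub_eq_add_neg]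
    rw [h₂]
    exact Submodule.add_mem _ h₁
      (Submodule.smul_mem _ _ (Finsupp.supported_mono Iio_subset_Iic_self hv))
  · have h0 : v j = 0 :=
      Finsupp.notMem_support_iff.1 fun h => lt_irrefl j ((mem_supported _ _).1 hv h)
    rw [Finsupp.sub_apply, h0, sub_zero, single_eq_same] at hwj
    have h₁ := hr (w j).1
    rw [← hwj] at h₁
    have h₂ := (isPSeminorm_cost (prob := prob) hp).nonneg (w.erase j)
    rw [cost_eq_add_erase hp w j]
    exact le_add_of_le_of_nonneg h₁ h₂

end Order

end Amalgam

/-! ### Counting problems and enumerating them -/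

section Cardinality

open Set Cardinal

theorem IsPSeminorm.add {𝕜 : Type*} [RCLike 𝕜] {p : ℝ} {E : Type*} [AddCommGroup E] [Module 𝕜 E]
    {M N : E → ℝ} (hM : IsPSeminorm 𝕜 p M) (hN : IsPSeminorm 𝕜 p N) :
    IsPSeminorm 𝕜 p (fun x => M x + N x) where
  nonneg x := add_nonneg (hM.nonneg x) (hN.nonneg x)
  add_le x y := by linarith [hM.add_le x y, hN.add_le x y]
  smul c x := by rw [hM.smul, hN.smul, mul_add]

theorem isPSeminorm_norm_rpow_apply (𝕜 : Type*) [RCLike 𝕜] {p : ℝ} (hp₀ : 0 < p) (hp₁ : p ≤ 1) :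
    IsPSeminorm 𝕜 p (fun t : 𝕜 => ‖t‖ ^ p) where
  nonneg t := Real.rpow_nonneg (norm_nonneg t) _
  add_le s t := (Real.rpow_le_rpow (norm_nonneg _) (norm_add_le s t) hp₀.le).trans
    (Real.rpow_add_le_add_rpow (norm_nonneg s) (norm_nonneg t) hp₀.le hp₁)
  smul c t := by rw [smul_eq_mul, norm_mul, Real.mul_rpow (norm_nonneg _) (norm_nonneg _)]

theorem IsPSeminorm.exists_denseSeq_lt {𝕜 : Type*} [RCLike 𝕜] {p : ℝ} (hp : 0 < p) {E : Type*}
    [AddCommGroup E] [Module 𝕜 E] {N : E → ℝ} (hN : IsPSeminorm 𝕜 p N) (f : 𝕜 →ₗ[𝕜] E) (t : 𝕜)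
    {ε : ℝ} (hε : 0 < ε) : ∃ k, N (f t - f (TopologicalSpace.denseSeq 𝕜 k)) < ε := by
  have hcont : Continuous fun s : 𝕜 => ‖t - s‖ ^ p * N (f 1) :=
    ((continuous_const.sub continuous_id).norm.rpow_const fun _ => Or.inr hp.le).mul
      continuous_const
  obtain ⟨k, hk⟩ := (TopologicalSpace.denseRange_denseSeq 𝕜).exists_mem_open
    (isOpen_Iio.preimage hcont : IsOpen {s : 𝕜 | ‖t - s‖ ^ p * N (f 1) < ε})
    ⟨t, by simpa [Real.zero_rpow hp.ne'] using hε⟩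
  refine ⟨k, ?_⟩
  have h : f t - f (TopologicalSpace.denseSeq 𝕜 k) =
      (t - TopologicalSpace.denseSeq 𝕜 k) • f 1 := by
    rw [← map_sub, ← map_smul, smul_eq_mul, mul_one]
  rw [h, hN.smul]
  exact hk

/-- A sequence of pairs of coefficient sequences that is dense for every `p`-seminorm. -/
theorem exists_seq_determining (𝕜 : Type*) [RCLike 𝕜] {p : ℝ} (hp : 0 < p) :
    ∃ d : ℕ → (ℕ →₀ 𝕜) × (ℕ →₀ 𝕜), ∀ M M' : (ℕ →₀ 𝕜) × (ℕ →₀ 𝕜) → ℝ, IsPSeminorm 𝕜 p M →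
      IsPSeminorm 𝕜 p M' → (∀ n, M (d n) = M' (d n)) → M = M' := by
  let g : (ℕ × ℕ) ⊕ (ℕ × ℕ) → (ℕ →₀ 𝕜) × (ℕ →₀ 𝕜) := Sum.elim
    (fun q => (Finsupp.single q.1 (TopologicalSpace.denseSeq 𝕜 q.2), 0))
    (fun q => (0, Finsupp.single q.1 (TopologicalSpace.denseSeq 𝕜 q.2)))
  obtain ⟨σ, hσ⟩ := exists_surjective_nat (List ((ℕ × ℕ) ⊕ (ℕ × ℕ)))
  refine ⟨fun n => ((σ n).map g).sum, fun M M' hM hM' h => ?_⟩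
  -- Approximating with respect to the sum lets one approximant serve both seminorms.
  have hN := hM.add hM'
  have key : ∀ c, ∀ ε > 0, ∃ l : List ((ℕ × ℕ) ⊕ (ℕ × ℕ)),
      M (c - (l.map g).sum) + M' (c - (l.map g).sum) < ε := by
    have hadd : ∀ c c', (∀ ε > 0, ∃ l : List ((ℕ × ℕ) ⊕ (ℕ × ℕ)),
        M (c - (l.map g).sum) + M' (c - (l.map g).sum) < ε) →
        (∀ ε > 0, ∃ l : List ((ℕ × ℕ) ⊕ (ℕ × ℕ)),
        M (c' - (l.map g).sum) + M' (c' - (l.map g).sum) < ε) →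
        ∀ ε > 0, ∃ l : List ((ℕ × ℕ) ⊕ (ℕ × ℕ)),
        M (c + c' - (l.map g).sum) + M' (c + c' - (l.map g).sum) < ε := by
      intro c c' hc hc' ε hε
      obtain ⟨l, hl⟩ := hc _ (half_pos hε)
      obtain ⟨l', hl'⟩ := hc' _ (half_pos hε)
      refine ⟨l ++ l', ?_⟩
      rw [List.map_append, List.sum_append, add_sub_add_comm]
      have := hN.add_le (c - (l.map g).sum) (c' - (l'.map g).sum)
      linarith
    have hzero : ∀ ε > 0, ∃ l : List ((ℕ × ℕ) ⊕ (ℕ × ℕ)),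
        M (0 - (l.map g).sum) + M' (0 - (l.map g).sum) < ε := by
      intro ε hε
      refine ⟨[], ?_⟩
      simpa [hM.map_zero hp, hM'.map_zero hp] using hε
    have hl : ∀ a : ℕ →₀ 𝕜, ∀ ε > 0, ∃ l : List ((ℕ × ℕ) ⊕ (ℕ × ℕ)),
        M ((a, 0) - (l.map g).sum) + M' ((a, 0) - (l.map g).sum) < ε := by
      intro a
      induction a using Finsupp.induction_linear with
      | zero => exact hzero
      | add a a' ha ha' =>
        have h := hadd (a, 0) (a', 0) ha ha'
        rwa [Prod.mk_add_mk, add_zero] at h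
      | single n t =>
        intro ε hε
        obtain ⟨k, hk⟩ := hN.exists_denseSeq_lt hp
          ((LinearMap.inl 𝕜 (ℕ →₀ 𝕜) (ℕ →₀ 𝕜)).comp (Finsupp.lsingle n)) t hε
        exact ⟨[Sum.inl (n, k)], by simpa [g] using hk⟩
    have hr : ∀ a : ℕ →₀ 𝕜, ∀ ε > 0, ∃ l : List ((ℕ × ℕ) ⊕ (ℕ × ℕ)),
        M ((0, a) - (l.map g).sum) + M' ((0, a) - (l.map g).sum) < ε := by
      intro a
      induction a using Finsupp.induction_linear with
      | zero => exact hzero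
      | add a a' ha ha' =>
        have h := hadd (0, a) (0, a') ha ha'
        rwa [Prod.mk_add_mk, add_zero] at h
      | single n t =>
        intro ε hε
        obtain ⟨k, hk⟩ := hN.exists_denseSeq_lt hp
          ((LinearMap.inr 𝕜 (ℕ →₀ 𝕜) (ℕ →₀ 𝕜)).comp (Finsupp.lsingle n)) t hε
        exact ⟨[Sum.inr (n, k)], by simpa [g] using hk⟩
    rintro ⟨a, b⟩
    have h := hadd (a, 0) (0, b) (hl a) (hr b)
    rwa [Prod.mk_add_mk, add_zero, zero_add] at h
  funext c
  refine eq_of_forall_dist_le fun ε hε => ?_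
  obtain ⟨l, hl⟩ := key c ε hε
  obtain ⟨n, rfl⟩ := hσ l
  have h₁ := hM.abs_sub_le c ((σ n).map g).sum
  have h₂ := hM'.abs_sub_le c ((σ n).map g).sum
  have h₃ := h n
  simp only at h₃
  rw [Real.dist_eq]
  rw [abs_le] at h₁ h₂ ⊢
  constructor <;> linarith

theorem mk_le_continuum_of_rclike (𝕜 : Type w) [RCLike 𝕜] : #𝕜 ≤ 𝔠 := by
  have hinj : Function.Injective fun z : 𝕜 => (RCLike.re z, RCLike.im z) := fun z z' h =>
    RCLike.ext (congrArg Prod.fst h) (congrArg Prod.snd h)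
  have h := lift_mk_le_lift_mk_of_injective hinj
  simpa [mk_real] using h

theorem mk_extensionProblem_le (𝕜 : Type w) [RCLike 𝕜] {p : ℝ} (hp : 0 < p) {V : Type w}
    (hV : #V ≤ 𝔠) : #(ExtensionProblem 𝕜 p V) ≤ 𝔠 := by
  obtain ⟨d, hd⟩ := exists_seq_determining 𝕜 hp
  have hinj : Function.Injective fun P : ExtensionProblem 𝕜 p V => (P.x, fun n => P.M (d n)) :=
    fun P Q h => ExtensionProblem.ext (congrArg Prod.fst h)
      (hd _ _ P.isPSeminorm Q.isPSeminorm fun n => congrFun (congrArg Prod.snd h) n)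
  have h := mk_le_of_injective hinj
  refine h.trans ?_
  have h₁ : #(ℕ → V) ≤ 𝔠 := by
    rw [mk_pi, prod_const, mk_nat, lift_aleph0, lift_uzero, ← continuum_power_aleph0]
    exact power_le_power_right hV
  have h₂ : #(ℕ → ℝ) = 𝔠 := by simp [mk_real]
  have h₃ : lift.{w} #(ℕ → ℝ) ≤ 𝔠 := by rw [h₂, lift_continuum]
  rw [mk_prod, lift_uzero]
  exact (mul_le_mul' h₁ h₃).trans continuum_mul_self.le

/-- The order is the initial ordinal of the continuum; countable sets are bounded because the
cofinality of `2 ^ ℵ₀` is uncountable (König). -/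
theorem exists_wellOrder_continuum :
    ∃ (I : Type w) (_ : LinearOrder I), WellFoundedLT I ∧ #I = 𝔠 ∧ (∀ i : I, #(Iio i) < 𝔠) ∧
      ∀ A : Set I, A.Countable → ∃ i, A ⊆ Iio i := by
  have hI : #(𝔠 : Cardinal.{w}).ord.ToType = 𝔠 := by simp
  refine ⟨(𝔠 : Cardinal.{w}).ord.ToType, inferInstance, inferInstance, hI, fun i => ?_,
    fun A hA => ?_⟩
  · exact (mk_Iio_lt i (by simp)).trans_eq hI
  · have hcof : ℵ₀ < Order.cof (𝔠 : Cardinal.{w}).ord.ToType := by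
      rw [Ordinal.cof_toType, ← two_power_aleph0]
      exact lt_cof_ord_power le_rfl one_lt_two
    have hnot : ¬ IsCofinal A := fun h =>
      absurd (Order.cof_le h) (not_le.2 ((le_aleph0_iff_set_countable.2 hA).trans_lt hcof))
    simp only [IsCofinal, not_forall, not_exists, not_and, not_le] at hnot
    obtain ⟨i, hi⟩ := hnot
    exact ⟨i, fun a ha => hi a ha⟩

/-- Project a bijection `I ≃ I × P` to `P`: each fibre has size continuum, too large to lie in an
initial segment. -/
theorem exists_enumeration_continuum {I P : Type w} [LinearOrder I] (hI : #I = 𝔠)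
    (hlt : ∀ i : I, #(Iio i) < 𝔠) [Nonempty P] (hP : #P ≤ 𝔠) :
    ∃ e : I → P, ∀ q, #(e ⁻¹' {q}) = 𝔠 ∧ ∀ i, ∃ j, i ≤ j ∧ e j = q := by
  have hIP : #I = #(I × P) := by
    rw [mk_prod, lift_id, lift_id, hI, mul_eq_left aleph0_le_continuum hP (mk_ne_zero P)]
  obtain ⟨φ⟩ := Cardinal.eq.1 hIP
  have hcard : ∀ q, #((fun i => (φ i).2) ⁻¹' {q}) = 𝔠 := by
    intro q
    refine le_antisymm ((mk_set_le _).trans hI.le) ?_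
    refine hI.ge.trans (mk_le_of_injective (f := fun k => ⟨φ.symm (k, q), by simp⟩)
      fun k k' h => ?_)
    simpa using h
  refine ⟨fun i => (φ i).2, fun q => ⟨hcard q, fun i => ?_⟩⟩
  by_contra! hcon
  have hsub : (fun i => (φ i).2) ⁻¹' {q} ⊆ Iio i := fun j hj => by
    by_contra hj'
    exact hcon j (not_lt.1 hj') hj
  exact absurd ((mk_le_mk_of_subset hsub).trans_lt (hlt i)) (by rw [hcard q]; exact lt_irrefl _)

end Cardinality

/-! ### The universal seminormed space -/

open Cardinal Set in
/-- A `p`-seminormed space of cardinality at most the continuum in which all extension problems can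
be solved and which contains a `1`-separated set of cardinality the continuum. -/
theorem exists_pSeminorm_solving (𝕜 : Type w) [RCLike 𝕜] {p : ℝ} (hp₀ : 0 < p) (hp₁ : p ≤ 1) :
    ∃ (V : Type w) (_ : AddCommGroup V) (_ : Module 𝕜 V) (N : V → ℝ), IsPSeminorm 𝕜 p N ∧
      #V ≤ 𝔠 ∧
      SolvesExtensionProblems 𝕜 p N ∧
      ∃ (J : Type w) (z : J → V), #J = 𝔠 ∧ ∀ j k, j ≠ k → 1 ≤ N (z j - z k) := by
  obtain ⟨I, _, _, hI, hlt, hbdd⟩ := exists_wellOrder_continuum.{w}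
  have hV : #(I →₀ (ℕ →₀ 𝕜)) ≤ 𝔠 := by
    have : Infinite I := infinite_iff.2 (hI ▸ aleph0_le_continuum)
    have h𝕜 : #𝕜 ≤ 𝔠 := mk_le_continuum_of_rclike 𝕜
    rw [mk_finsupp_of_infinite, mk_finsupp_lift_of_infinite]
    simp [hI, h𝕜]
  -- This problem ignores the old vectors, so its zeroth new generator is at distance at least `1`
  -- from everything earlier.
  let P₁ : ExtensionProblem 𝕜 p (I →₀ (ℕ →₀ 𝕜)) :=
    ⟨0, fun c => ‖c.2 0‖ ^ p, (isPSeminorm_norm_rpow_apply 𝕜 hp₀ hp₁).comp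
      ((Finsupp.lapply 0).comp (LinearMap.snd 𝕜 (ℕ →₀ 𝕜) (ℕ →₀ 𝕜)))⟩
  have : Nonempty (ExtensionProblem 𝕜 p (I →₀ (ℕ →₀ 𝕜))) := ⟨P₁⟩
  obtain ⟨e, he⟩ := exists_enumeration_continuum hI hlt (mk_extensionProblem_le 𝕜 hp₀ hV)
  obtain ⟨prob, hcons, hprob⟩ := Amalgam.exists_consistent hp₀ e
  refine ⟨I →₀ (ℕ →₀ 𝕜), inferInstance, inferInstance, Amalgam.gauge prob univ,
    Amalgam.isPSeminorm_gauge hp₀, hV, fun x M hM hx => ?_, ?_⟩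
  · obtain ⟨i, hi⟩ := hbdd (⋃ n, (x n).support) (countable_iUnion fun n => Finset.countable_toSet _)
    obtain ⟨j, hij, hj⟩ := (he ⟨x, M, hM⟩).2 i
    have hxj : ∀ n, x n ∈ Finsupp.supported (ℕ →₀ 𝕜) 𝕜 (Iio j) := fun n =>
      (Finsupp.mem_supported _ _).2
        ((subset_iUnion (fun n => ((x n).support : Set I)) n).trans
          (hi.trans (Iio_subset_Iio hij)))
    have hpj : prob j = ⟨x, M, hM⟩ := by
      rw [← hj]
      refine hprob j ?_
      rw [hj]
      refine ⟨hxj, fun a => ?_⟩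
      rw [Amalgam.gauge_eq_gauge_univ hcons hp₀ (isLowerSet_Iio j)]
      · exact hx a
      · exact Submodule.sum_mem _ fun n _ => Submodule.smul_mem _ _ (hxj n)
    refine ⟨fun n => Finsupp.single j (Finsupp.single n 1), fun c => ?_⟩
    have h := Amalgam.gauge_pieceMap hcons hp₀ j c
    rw [Amalgam.pieceMap_apply, hpj] at h
    have hy : Finsupp.linearCombination 𝕜
        (fun n : ℕ => Finsupp.single j (Finsupp.single n (1 : 𝕜))) = Finsupp.lsingle j := by
      ext n : 2
      simp
    exact (congrArg (fun t => Amalgam.gauge prob univ (Finsupp.linearCombination 𝕜 x c.1 + t))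
      (LinearMap.congr_fun hy c.2)).trans h
  · have hj₁ : ∀ j, e j = P₁ → prob j = P₁ := by
      intro j hj
      rw [← hj]
      refine hprob j ?_
      rw [hj]
      refine ⟨fun n => Submodule.zero_mem _, fun a => ?_⟩
      simp [P₁, Amalgam.gauge_zero hp₀, Real.zero_rpow hp₀.ne']
    have hsep : ∀ j k, e j = P₁ → k < j → 1 ≤ Amalgam.gauge prob univ
        (Finsupp.single j (Finsupp.single 0 1) - Finsupp.single k (Finsupp.single 0 1)) := by
      intro j k hj hkj
      refine Amalgam.le_gauge_single_sub hcons hp₀ (fun a => ?_)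
        (Finsupp.single_mem_supported _ _ hkj)
      rw [hj₁ j hj]
      simp [P₁]
    refine ⟨e ⁻¹' {P₁}, fun j => Finsupp.single (j : I) (Finsupp.single 0 1), (he P₁).1,
      fun j k hjk => ?_⟩
    rcases lt_or_gt_of_ne (Subtype.coe_injective.ne hjk) with h | h
    · rw [(Amalgam.isPSeminorm_gauge hp₀).map_sub_rev]
      exact hsep k j k.2 h
    · exact hsep j k j.2 h

/-! ### From seminorms to quasinormed spaces -/

open Filter Topology Uniformity Set

theorem IsPSeminorm.of_tendsto {𝕜 : Type*} [RCLike 𝕜] {p : ℝ} {E : Type*} [AddCommGroup E]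
    [Module 𝕜 E] {N : ℕ → E → ℝ} {M : E → ℝ} (hN : ∀ n, IsPSeminorm 𝕜 p (N n))
    (hM : ∀ x, Tendsto (fun n => N n x) atTop (𝓝 (M x))) : IsPSeminorm 𝕜 p M where
  nonneg x := ge_of_tendsto' (hM x) fun n => (hN n).nonneg x
  add_le x y := le_of_tendsto_of_tendsto' (hM (x + y)) ((hM x).add (hM y)) fun n =>
    (hN n).add_le x y
  smul c x := tendsto_nhds_unique (hM (c • x)) <| by
    simpa only [(hN _).smul] using (hM x).const_mul (‖c‖ ^ p)

theorem SolvesExtensionProblems.of_surjective {𝕜 : Type*} [RCLike 𝕜] {p : ℝ} {V U : Type*}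
    [AddCommGroup V] [Module 𝕜 V] [AddCommGroup U] [Module 𝕜 U] {N : V → ℝ} {q : U → ℝ}
    (hN : SolvesExtensionProblems 𝕜 p N) (π : V →ₗ[𝕜] U) (hπ : Function.Surjective π)
    (hq : ∀ v, q (π v) = N v) : SolvesExtensionProblems 𝕜 p q := by
  intro x M hM hx
  choose x' hx' using fun n => hπ (x n)
  obtain rfl : π ∘ x' = x := funext hx'
  obtain ⟨y, hy⟩ := hN x' M hM fun a => by
    rw [← hx a, ← Finsupp.apply_linearCombination, hq]
  refine ⟨π ∘ y, fun c => ?_⟩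
  rw [← Finsupp.apply_linearCombination, ← Finsupp.apply_linearCombination, ← map_add, hq, hy]

/-- The quasinorm whose `p`-th power is a given `p`-homogeneous subadditive function. -/
noncomputable abbrev IsPSeminorm.toQuasiNormedAddCommGroup {𝕜 : Type*} [RCLike 𝕜] {p : ℝ}
    (hp : 0 < p) {U : Type*} [AddCommGroup U] [Module 𝕜 U] {q : U → ℝ} (hq : IsPSeminorm 𝕜 p q)
    (h0 : ∀ x, q x = 0 → x = 0) : QuasiNormedAddCommGroup U where
  norm x := q x ^ p⁻¹
  norm_nonneg' x := Real.rpow_nonneg (hq.nonneg x) _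
  norm_zero' := by
    change q 0 ^ p⁻¹ = 0
    rw [hq.map_zero hp, Real.zero_rpow (inv_ne_zero hp.ne')]
  norm_neg' x := by
    change q (-x) ^ p⁻¹ = q x ^ p⁻¹
    rw [hq.map_neg]
  eq_zero_of_norm_eq_zero' x hx :=
    h0 x ((Real.rpow_eq_zero (hq.nonneg x) (inv_ne_zero hp.ne')).1 hx)
  exists_norm_add_le' := by
    refine ⟨2 ^ p⁻¹, fun x y => ?_⟩
    change q (x + y) ^ p⁻¹ ≤ 2 ^ p⁻¹ * (q x ^ p⁻¹ + q y ^ p⁻¹)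
    have hp' : 0 ≤ p⁻¹ := inv_nonneg.2 hp.le
    have hx := Real.rpow_nonneg (hq.nonneg x) p⁻¹
    have hy := Real.rpow_nonneg (hq.nonneg y) p⁻¹
    have h2 : (0 : ℝ) ≤ 2 ^ p⁻¹ := by positivity
    rcases le_total (q x) (q y) with h | h
    · calc q (x + y) ^ p⁻¹ ≤ (2 * q y) ^ p⁻¹ :=
            Real.rpow_le_rpow (hq.nonneg _) (by linarith [hq.add_le x y]) hp'
        _ = 2 ^ p⁻¹ * q y ^ p⁻¹ := Real.mul_rpow zero_le_two (hq.nonneg y)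
        _ ≤ _ := mul_le_mul_of_nonneg_left (by linarith) h2
    · calc q (x + y) ^ p⁻¹ ≤ (2 * q x) ^ p⁻¹ :=
            Real.rpow_le_rpow (hq.nonneg _) (by linarith [hq.add_le x y]) hp'
        _ = 2 ^ p⁻¹ * q x ^ p⁻¹ := Real.mul_rpow zero_le_two (hq.nonneg x)
        _ ≤ _ := mul_le_mul_of_nonneg_left (by linarith) h2

/-- The quotient by the null space has at most continuum many points, so it has a copy in any
universe. -/
theorem IsPSeminorm.exists_small_quotient {𝕜 : Type*} [RCLike 𝕜] {p : ℝ} (hp : 0 < p)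
    {V : Type w} [AddCommGroup V] [Module 𝕜 V] {N : V → ℝ} (hN : IsPSeminorm 𝕜 p N)
    (hV : #V ≤ 𝔠) :
    ∃ (U : Type u) (_ : AddCommGroup U) (_ : Module 𝕜 U) (π : V →ₗ[𝕜] U) (q : U → ℝ),
      Function.Surjective π ∧ (∀ v, q (π v) = N v) ∧ IsPSeminorm 𝕜 p q ∧
      (∀ x, q x = 0 → x = 0) ∧ #U ≤ 𝔠 := by
  let K : Submodule 𝕜 V :=
    { carrier := {v | N v = 0}
      add_mem' := fun {a b} (ha : N a = 0) (hb : N b = 0) =>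
        le_antisymm ((hN.add_le a b).trans (by rw [ha, hb, add_zero])) (hN.nonneg _)
      zero_mem' := hN.map_zero hp
      smul_mem' := fun c x (hx : N x = 0) => by
        change N (c • x) = 0
        rw [hN.smul, hx, mul_zero] }
  have hQ : #(V ⧸ K) ≤ 𝔠 := (Cardinal.mk_le_of_surjective K.mkQ_surjective).trans hV
  have hsmall : Small.{u} (V ⧸ K) := by
    obtain ⟨C, hC⟩ : ∃ C : Type u, #C = 𝔠 := ⟨_, Cardinal.mk_out 𝔠⟩
    have h : Cardinal.lift.{u} #(V ⧸ K) ≤ Cardinal.lift.{w} #C := by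
      rw [hC, Cardinal.lift_continuum]
      exact (Cardinal.lift_le.2 hQ).trans_eq Cardinal.lift_continuum
    obtain ⟨f⟩ := Cardinal.lift_mk_le'.1 h
    exact small_of_injective f.injective
  let φ : Shrink.{u} (V ⧸ K) ≃ₗ[𝕜] (V ⧸ K) := Shrink.linearEquiv 𝕜 (V ⧸ K)
  let π : V →ₗ[𝕜] Shrink.{u} (V ⧸ K) := φ.symm.toLinearMap.comp K.mkQ
  have hπ : Function.Surjective π := φ.symm.surjective.comp K.mkQ_surjective
  have hker : ∀ v, π v = 0 ↔ N v = 0 := fun v => by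
    change φ.symm (K.mkQ v) = 0 ↔ v ∈ K
    rw [LinearEquiv.map_eq_zero_iff, Submodule.mkQ_apply, Submodule.Quotient.mk_eq_zero]
  have hq : ∀ v, N (Function.surjInv hπ (π v)) = N v := fun v => by
    have h : N (Function.surjInv hπ (π v) - v) = 0 := by
      rw [← hker, map_sub, Function.surjInv_eq hπ, sub_self]
    have h' := hN.abs_sub_le (Function.surjInv hπ (π v)) v
    rw [h] at h'
    exact sub_eq_zero.1 (abs_nonpos_iff.1 h')
  refine ⟨Shrink.{u} (V ⧸ K), inferInstance, inferInstance, π,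
    fun x => N (Function.surjInv hπ x), hπ, hq, ⟨fun x => hN.nonneg _, fun x y => ?_, fun c x => ?_⟩,
    fun x hx => ?_, ?_⟩
  · obtain ⟨a, rfl⟩ := hπ x
    obtain ⟨b, rfl⟩ := hπ y
    rw [← map_add, hq, hq, hq]
    exact hN.add_le a b
  · obtain ⟨a, rfl⟩ := hπ x
    rw [← map_smul, hq, hq, hN.smul]
  · obtain ⟨a, rfl⟩ := hπ x
    exact (hker a).2 ((hq a).symm.trans hx)
  · have h := Cardinal.mk_congr_lift (equivShrink.{u} (V ⧸ K))
    rw [← Cardinal.lift_le_continuum.{u, w}, ← h, Cardinal.lift_le_continuum]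
    exact hQ

namespace QuasiNormedAddCommGroup

variable {𝕜 : Type*} [RCLike 𝕜] {p : ℝ} {X : Type*} [QuasiNormedAddCommGroup X]
  [QuasiNormedSpace 𝕜 X]

theorem isPSeminorm_norm_rpow (h : ∀ x y : X, ‖x + y‖ ^ p ≤ ‖x‖ ^ p + ‖y‖ ^ p) :
    IsPSeminorm 𝕜 p (fun x : X => ‖x‖ ^ p) where
  nonneg x := Real.rpow_nonneg (norm_nonneg' x) _
  add_le := h
  smul c x := by
    rw [QuasiNormedSpace.norm_smul', Real.mul_rpow (norm_nonneg c) (norm_nonneg' x)]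

theorem eq_of_norm_sub_rpow_eq_zero (hp : 0 < p) {x y : X} (h : ‖x - y‖ ^ p = 0) : x = y :=
  sub_eq_zero.1 (eq_zero_of_norm_eq_zero' _
    ((Real.rpow_eq_zero (norm_nonneg' _) hp.ne').1 h))

theorem eq_of_norm_rpow_eq {Y : Type*} [QuasiNormedAddCommGroup Y] (hp : 0 < p) {x : X} {y : Y}
    (h : ‖x‖ ^ p = ‖y‖ ^ p) : ‖x‖ = ‖y‖ :=
  (Real.rpow_left_inj (norm_nonneg' _) (norm_nonneg' _) hp.ne').1 h

theorem hasBasis_uniformity (hp : 0 < p) :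
    (𝓤 X).HasBasis (fun ε : ℝ => 0 < ε) fun ε => {q : X × X | ‖q.2 - q.1‖ ^ p < ε} := by
  have h : 𝓤 X = (entourageBasis X).filter := rfl
  rw [h]
  refine (entourageBasis X).hasBasis.to_hasBasis ?_ ?_
  · rintro _ ⟨ε, hε, rfl⟩
    refine ⟨ε ^ p, Real.rpow_pos_of_pos hε p, fun q hq => ?_⟩
    exact (Real.rpow_lt_rpow_iff (norm_nonneg' _) hε.le hp).1 hq
  · intro ε hε
    refine ⟨_, ⟨ε ^ p⁻¹, Real.rpow_pos_of_pos hε _, rfl⟩, fun q hq => ?_⟩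
    exact (Real.lt_rpow_inv_iff_of_pos (norm_nonneg' _) hε.le hp).1 hq

theorem hasBasis_nhds (hp : 0 < p) (x : X) :
    (𝓝 x).HasBasis (fun ε : ℝ => 0 < ε) fun ε => {y | ‖y - x‖ ^ p < ε} :=
  nhds_basis_uniformity' (hasBasis_uniformity hp)

theorem isCountablyGenerated_uniformity (hp : 0 < p) : (𝓤 X).IsCountablyGenerated := by
  have h : (𝓤 X).HasBasis (fun _ : ℕ => True)
      fun n => {q : X × X | ‖q.2 - q.1‖ ^ p < 1 / ((n : ℝ) + 1)} := by
    refine (hasBasis_uniformity hp).to_hasBasis (fun ε hε => ?_) fun n _ =>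
      ⟨_, Nat.one_div_pos_of_nat, Subset.rfl⟩
    obtain ⟨n, hn⟩ := exists_nat_one_div_lt hε
    exact ⟨n, trivial, fun q hq => lt_trans hq hn⟩
  exact h.isCountablyGenerated

theorem cauchySeq_iff (hp : 0 < p) {s : ℕ → X} :
    CauchySeq s ↔ ∀ ε > 0, ∃ n₀, ∀ m, n₀ ≤ m → ∀ n, n₀ ≤ n → ‖s n - s m‖ ^ p < ε :=
  (hasBasis_uniformity hp).cauchySeq_iff

theorem tendsto_iff (hp : 0 < p) {s : ℕ → X} {x : X} :
    Tendsto s atTop (𝓝 x) ↔ ∀ ε > 0, ∃ n₀, ∀ n ≥ n₀, ‖s n - x‖ ^ p < ε := by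
  simp [(hasBasis_nhds hp x).tendsto_right_iff, eventually_atTop]

end QuasiNormedAddCommGroup

open QuasiNormedAddCommGroup

/-- An isometry defined on a dense subspace extends to an isometry. -/
theorem exists_isometry_extension {𝕜 : Type*} [RCLike 𝕜] {p : ℝ} (hp : 0 < p) {E Y U : Type*}
    [AddCommGroup E] [Module 𝕜 E] [QuasiNormedAddCommGroup Y] [QuasiNormedSpace 𝕜 Y]
    [QuasiNormedAddCommGroup U] [QuasiNormedSpace 𝕜 U]
    (hY : IsPSeminorm 𝕜 p fun y : Y => ‖y‖ ^ p) (hU : IsPSeminorm 𝕜 p fun x : U => ‖x‖ ^ p)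
    [CompleteSpace U] (Φ : E →ₗ[𝕜] Y) (Ψ : E →ₗ[𝕜] U) (h : ∀ c, ‖Ψ c‖ = ‖Φ c‖)
    (hΦ : ∀ y, ∀ ε > 0, ∃ c, ‖y - Φ c‖ ^ p < ε) :
    ∃ f : Y →ₗ[𝕜] U, (∀ y, ‖f y‖ = ‖y‖) ∧ ∀ c, f (Φ c) = Ψ c := by
  -- `R` is the closure of the graph `{(Φ c, Ψ c)}`; it is shown to be the graph of a linear
  -- isometry, total because `U` is complete.
  let R (y : Y) (x : U) : Prop := ∀ ε > 0, ∃ c, ‖y - Φ c‖ ^ p < ε ∧ ‖x - Ψ c‖ ^ p < ε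
  have R_self : ∀ c, R (Φ c) (Ψ c) := fun c ε hε => by
    refine ⟨c, ?_, ?_⟩
    · simpa only [sub_self, hY.map_zero hp] using hε
    · simpa only [sub_self, hU.map_zero hp] using hε
  have R_add : ∀ {y y' x x'}, R y x → R y' x' → R (y + y') (x + x') := by
    intro y y' x x' hyx hyx' ε hε
    obtain ⟨c, h₁, h₂⟩ := hyx _ (half_pos hε)
    obtain ⟨c', h₁', h₂'⟩ := hyx' _ (half_pos hε)
    refine ⟨c + c', ?_, ?_⟩
    · rw [map_add, add_sub_add_comm]
      linarith [hY.add_le (y - Φ c) (y' - Φ c')]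
    · rw [map_add, add_sub_add_comm]
      linarith [hU.add_le (x - Ψ c) (x' - Ψ c')]
  have R_smul : ∀ (t : 𝕜) {y x}, R y x → R (t • y) (t • x) := by
    intro t y x hyx ε hε
    have ht : 0 ≤ ‖t‖ ^ p := Real.rpow_nonneg (norm_nonneg t) p
    obtain ⟨c, h₁, h₂⟩ := hyx (ε / (‖t‖ ^ p + 1)) (by positivity)
    rw [lt_div_iff₀ (by positivity)] at h₁ h₂
    refine ⟨t • c, ?_, ?_⟩
    · rw [map_smul, ← smul_sub, hY.smul]
      linarith [hY.nonneg (y - Φ c)]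
    · rw [map_smul, ← smul_sub, hU.smul]
      linarith [hU.nonneg (x - Ψ c)]
  have R_norm : ∀ {y x}, R y x → ‖x‖ ^ p = ‖y‖ ^ p := by
    intro y x hyx
    refine eq_of_forall_dist_le fun ε hε => ?_
    obtain ⟨c, h₁, h₂⟩ := hyx _ (half_pos hε)
    have h₃ := hY.abs_sub_le y (Φ c)
    have h₄ := hU.abs_sub_le x (Ψ c)
    simp only [h] at h₄
    rw [Real.dist_eq]
    rw [abs_le] at h₃ h₄ ⊢
    constructor <;> linarith
  have R_unique : ∀ {y x x'}, R y x → R y x' → x = x' := by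
    intro y x x' hx hx'
    have h₁ := R_norm (R_add hx (R_smul (-1) hx'))
    simp only [neg_smul, one_smul, ← sub_eq_add_neg, sub_self, hY.map_zero hp] at h₁
    exact eq_of_norm_sub_rpow_eq_zero hp h₁
  have R_exists : ∀ y, ∃ x, R y x := by
    intro y
    choose c hc using fun n : ℕ => hΦ y (1 / ((n : ℝ) + 1)) Nat.one_div_pos_of_nat
    have hsmall : ∀ ε > 0, ∃ n₀, ∀ n, n₀ ≤ n → ‖y - Φ (c n)‖ ^ p < ε := by
      intro ε hε
      obtain ⟨n₀, hn₀⟩ := exists_nat_one_div_lt hε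
      exact ⟨n₀, fun n hn => (hc n).trans ((Nat.one_div_le_one_div hn).trans_lt hn₀)⟩
    have hcauchy : CauchySeq fun n => Ψ (c n) := by
      rw [cauchySeq_iff hp]
      intro ε hε
      obtain ⟨n₀, hn₀⟩ := hsmall _ (half_pos hε)
      refine ⟨n₀, fun m hm n hn => ?_⟩
      have h₁ := hY.sub_le_add (Φ (c n)) y (Φ (c m))
      have h₂ := hY.map_sub_rev (Φ (c n)) y
      rw [← map_sub, h, map_sub]
      linarith [hn₀ m hm, hn₀ n hn]
    obtain ⟨x, hx⟩ := cauchySeq_tendsto_of_complete hcauchy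
    rw [tendsto_iff hp] at hx
    refine ⟨x, fun ε hε => ?_⟩
    obtain ⟨n₁, hn₁⟩ := hsmall ε hε
    obtain ⟨n₂, hn₂⟩ := hx ε hε
    refine ⟨c (max n₁ n₂), hn₁ _ (le_max_left _ _), ?_⟩
    have h₂ := hU.map_sub_rev x (Ψ (c (max n₁ n₂)))
    rw [h₂]
    exact hn₂ _ (le_max_right _ _)
  choose f hf using R_exists
  refine ⟨{ toFun := f
            map_add' := fun y y' => R_unique (hf _) (R_add (hf y) (hf y'))
            map_smul' := fun t y => R_unique (hf _) (R_smul t (hf y)) }, fun y => ?_, fun c =>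
    R_unique (hf _) (R_self c)⟩
  exact eq_of_norm_rpow_eq hp (R_norm (hf y))

/-! ### Consequences of solvability -/

section Solving

variable {𝕜 : Type*} [RCLike 𝕜] {p : ℝ} {U : Type*} [QuasiNormedAddCommGroup U]
  [QuasiNormedSpace 𝕜 U]

/-- A virtual limit of a Cauchy sequence `s` is prescribed by `M (a, b) = lim ‖∑ aₙ sₙ + (∑ bₙ) sₘ‖
^ p` as `m → ∞`, every new generator standing for the limit. A solution `y` has `‖sₙ - y₀‖ ^ p = lim
‖sₙ - sₘ‖ ^ p`, which tends to `0`. -/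
theorem SolvesExtensionProblems.completeSpace (hp : 0 < p)
    (hU : IsPSeminorm 𝕜 p fun x : U => ‖x‖ ^ p)
    (hsolve : SolvesExtensionProblems 𝕜 p fun x : U => ‖x‖ ^ p) : CompleteSpace U := by
  have := isCountablyGenerated_uniformity (X := U) hp
  refine UniformSpace.complete_of_cauchySeq_tendsto fun s hs => ?_
  rw [cauchySeq_iff hp] at hs
  let σ : (ℕ →₀ 𝕜) →ₗ[𝕜] 𝕜 := Finsupp.linearCombination 𝕜 fun _ => 1
  let L (m : ℕ) : (ℕ →₀ 𝕜) × (ℕ →₀ 𝕜) →ₗ[𝕜] U :=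
    (Finsupp.linearCombination 𝕜 s).coprod (σ.smulRight (s m))
  have hL : ∀ m c, L m c = Finsupp.linearCombination 𝕜 s c.1 + σ c.2 • s m := fun m c => rfl
  have hlim : ∀ c, ∃ r, Tendsto (fun m => ‖L m c‖ ^ p) atTop (𝓝 r) := by
    intro c
    refine cauchySeq_tendsto_of_complete (Metric.cauchySeq_iff.2 fun ε hε => ?_)
    have ht : 0 ≤ ‖σ c.2‖ ^ p := Real.rpow_nonneg (norm_nonneg _) p
    obtain ⟨n₀, hn₀⟩ := hs (ε / (‖σ c.2‖ ^ p + 1)) (by positivity)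
    refine ⟨n₀, fun m hm n hn => ?_⟩
    have h₁ := hn₀ n hn m hm
    rw [lt_div_iff₀ (by positivity)] at h₁
    have h₂ := hU.abs_sub_le (L m c) (L n c)
    rw [hL, hL, add_sub_add_left_eq_sub, ← smul_sub, hU.smul] at h₂
    rw [Real.dist_eq, hL, hL]
    linarith [hU.nonneg (s m - s n)]
  choose M hM using hlim
  obtain ⟨y, hy⟩ := hsolve s M (.of_tendsto (fun m => hU.comp (L m)) hM) fun a => by
    refine tendsto_nhds_unique ?_ (hM (a, 0))
    simp only [hL, map_zero, zero_smul, add_zero]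
    exact tendsto_const_nhds
  refine ⟨y 0, (tendsto_iff hp).2 fun ε hε => ?_⟩
  obtain ⟨n₀, hn₀⟩ := hs _ (half_pos hε)
  refine ⟨n₀, fun n hn => ?_⟩
  have h₁ := hy (Finsupp.single n 1, -Finsupp.single 0 1)
  simp only [map_neg, Finsupp.linearCombination_single, one_smul, ← sub_eq_add_neg] at h₁
  rw [h₁]
  refine lt_of_le_of_lt (le_of_tendsto (hM _) ?_) (half_lt_self hε)
  filter_upwards [eventually_ge_atTop n₀] with m hm
  have h₂ := hn₀ m hm n hn
  simpa [hL, σ, ← sub_eq_add_neg] using h₂.le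

/-- The problem's seminorm is the norm of `Y` pulled back to coefficients of a sequence dense in
`g(X)` and one dense in `Y`. Its solution is an isometric copy of their span over `X`, and density
extends it to `Y` and the identity `f (g x) = x` to `X`. -/
theorem SolvesExtensionProblems.isOfUniversalDisposition (hp : 0 < p)
    (hU : IsPSeminorm 𝕜 p fun x : U => ‖x‖ ^ p)
    (hsolve : SolvesExtensionProblems 𝕜 p fun x : U => ‖x‖ ^ p) :
    IsOfUniversalDisposition 𝕜 U
      (fun (Y : Type v) _ _ => IsPBanachSpace p 𝕜 Y ∧ TopologicalSpace.SeparableSpace Y) := by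
  rintro Y _ _ ⟨hYB, _⟩ X g hg
  have hY : IsPSeminorm 𝕜 p fun y : Y => ‖y‖ ^ p := isPSeminorm_norm_rpow hYB.norm_add_rpow_le
  have := hsolve.completeSpace hp hU
  have := isCountablyGenerated_uniformity (X := Y) hp
  -- Separability alone need not pass to the subspace `range g`; second countability does.
  have : SecondCountableTopology Y := UniformSpace.secondCountable_of_separable Y
  choose x hx using fun n => (TopologicalSpace.denseSeq (range g) n).2
  let y : ℕ → Y := TopologicalSpace.denseSeq Y
  have hxdense : ∀ z, ∀ ε > 0, ∃ n, ‖g (x n) - g z‖ ^ p < ε := by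
    intro z ε hε
    obtain ⟨n, hn⟩ := (TopologicalSpace.denseRange_denseSeq (range g)).mem_nhds
      (continuous_subtype_val.continuousAt.preimage_mem_nhds
        ((hasBasis_nhds hp (g z)).mem_of_mem hε) : _ ∈ 𝓝 (⟨g z, mem_range_self z⟩ : range g))
    exact ⟨n, by rw [hx]; exact hn⟩
  have hydense : ∀ z, ∀ ε > 0, ∃ n, ‖y n - z‖ ^ p < ε := fun z ε hε =>
    (TopologicalSpace.denseRange_denseSeq Y).mem_nhds ((hasBasis_nhds hp z).mem_of_mem hε)
  let Φ : (ℕ →₀ 𝕜) × (ℕ →₀ 𝕜) →ₗ[𝕜] Y :=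
    (Finsupp.linearCombination 𝕜 (g ∘ x)).coprod (Finsupp.linearCombination 𝕜 y)
  obtain ⟨y', hy'⟩ := hsolve (X.subtype ∘ x) (fun c => ‖Φ c‖ ^ p) (hY.comp Φ) fun a => by
    simp only [Φ, LinearMap.coprod_apply, map_zero, add_zero]
    rw [← Finsupp.apply_linearCombination, ← Finsupp.apply_linearCombination, hg,
      Submodule.subtype_apply]
  let Ψ : (ℕ →₀ 𝕜) × (ℕ →₀ 𝕜) →ₗ[𝕜] U :=
    (Finsupp.linearCombination 𝕜 (X.subtype ∘ x)).coprod (Finsupp.linearCombination 𝕜 y')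
  obtain ⟨f, hf, hfΦ⟩ := exists_isometry_extension hp hY hU Φ Ψ
    (fun c => eq_of_norm_rpow_eq hp (hy' c))
    (fun z ε hε => by
      obtain ⟨n, hn⟩ := hydense z ε hε
      refine ⟨(0, Finsupp.single n 1), ?_⟩
      have h := hY.map_sub_rev z (y n)
      simpa [Φ, h] using hn)
  refine ⟨f, hf, fun z => eq_of_norm_sub_rpow_eq_zero hp ?_⟩
  refine le_antisymm (le_of_forall_pos_lt_add fun ε hε => ?_) (hU.nonneg _)
  obtain ⟨n, hn⟩ := hxdense z _ (half_pos hε)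
  have hfx : f (g (x n)) = x n := by
    have h := hfΦ (Finsupp.single n 1, 0)
    simpa [Φ, Ψ] using h
  have h₁ := hU.sub_le_add (f (g z)) (f (g (x n))) z
  have h₂ : ‖f (g z) - f (g (x n))‖ ^ p = ‖g (x n) - g z‖ ^ p := by
    rw [← map_sub, hf]
    exact hY.map_sub_rev _ _
  have h₃ : ‖f (g (x n)) - (z : U)‖ ^ p = ‖g (x n) - g z‖ ^ p := by
    rw [hfx, ← Submodule.coe_sub, ← map_sub, hg]
  simp only [h₂, h₃] at h₁
  linarith

end Solving

/-- Points of a dense set chosen within `1 / 2` (in `p`-th power) of the `z j` are distinct, since a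
shared one would put two of the `z j` at distance less than `1`. -/
theorem densityCharacter_eq_continuum {p : ℝ} (hp : 0 < p) {𝕜 : Type*} [RCLike 𝕜] {U : Type u}
    [QuasiNormedAddCommGroup U] [QuasiNormedSpace 𝕜 U]
    (hU : IsPSeminorm 𝕜 p fun x : U => ‖x‖ ^ p) (hcard : #U ≤ 𝔠) {J : Type w} (hJ : #J = 𝔠)
    (z : J → U) (hz : ∀ j k, j ≠ k → 1 ≤ ‖z j - z k‖ ^ p) : densityCharacter U = 𝔠 := by
  unfold densityCharacter
  have huniv : #U ∈ {κ | ∃ s : Set U, Dense s ∧ #s = κ} := ⟨univ, dense_univ, Cardinal.mk_univ⟩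
  refine le_antisymm ((csInf_le' huniv).trans hcard) (le_csInf ⟨_, huniv⟩ ?_)
  rintro _ ⟨s, hs, rfl⟩
  have hex : ∀ j, ∃ d : s, ‖(d : U) - z j‖ ^ p < 1 / 2 := fun j => by
    obtain ⟨d, hd, hd'⟩ := mem_closure_iff_nhds.1 (hs (z j)) _
      ((hasBasis_nhds hp (z j)).mem_of_mem (half_pos one_pos))
    exact ⟨⟨d, hd'⟩, hd⟩
  choose d hd using hex
  have hinj : Function.Injective d := by
    intro j k hjk
    by_contra hne
    have h₁ := hU.sub_le_add (z j) (d j) (z k)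
    have h₂ := hU.map_sub_rev (z j) (d j)
    have h₃ := hd k
    rw [← hjk] at h₃
    linarith [hz j k hne, hd j]
  have h := Cardinal.lift_mk_le_lift_mk_of_injective hinj
  rwa [hJ, Cardinal.lift_continuum, Cardinal.continuum_le_lift] at h

theorem theorem4p1 (𝕜 : Type w) [RCLike 𝕜] (p : ℝ) (hp₀ : 0 < p) (hp₁ : p ≤ 1) :
    ∃ (U : Type u) (_ : QuasiNormedAddCommGroup U) (_ : QuasiNormedSpace 𝕜 U),
      IsPBanachSpace p 𝕜 U ∧
      IsOfUniversalDisposition 𝕜 U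
        (fun (Y : Type v) _ _ => IsPBanachSpace p 𝕜 Y ∧ TopologicalSpace.SeparableSpace Y) ∧
      densityCharacter U = 𝔠 := by
  obtain ⟨V, _, _, N, hN, hV, hsolve, J, z, hJ, hz⟩ := exists_pSeminorm_solving 𝕜 hp₀ hp₁
  obtain ⟨U, _, _, π, q, hπ, hπq, hq, hq₀, hU⟩ := hN.exists_small_quotient.{w, u} hp₀ hV
  let : QuasiNormedAddCommGroup U := hq.toQuasiNormedAddCommGroup hp₀ hq₀
  have hnorm : ∀ x : U, ‖x‖ ^ p = q x := fun x => Real.rpow_inv_rpow (hq.nonneg x) hp₀.ne'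
  let : QuasiNormedSpace 𝕜 U :=
    { norm_smul' := fun c x => by
        change q (c • x) ^ p⁻¹ = ‖c‖ * q x ^ p⁻¹
        rw [hq.smul, Real.mul_rpow (Real.rpow_nonneg (norm_nonneg c) p) (hq.nonneg x),
          Real.rpow_rpow_inv (norm_nonneg c) hp₀.ne'] }
  have hfun : (fun x : U => ‖x‖ ^ p) = q := funext hnorm
  have hq' : IsPSeminorm 𝕜 p fun x : U => ‖x‖ ^ p := by rwa [hfun]
  have hsolve' : SolvesExtensionProblems 𝕜 p fun x : U => ‖x‖ ^ p :=
    SolvesExtensionProblems.of_surjective hsolve π hπ fun v => (hnorm _).trans (hπq v)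
  refine ⟨U, inferInstance, inferInstance, ⟨hq'.add_le, hsolve'.completeSpace hp₀ hq'⟩,
    hsolve'.isOfUniversalDisposition hp₀ hq',
    densityCharacter_eq_continuum hp₀ hq' hU hJ (fun j => π (z j)) fun j k hjk => ?_⟩
  rw [← map_sub, hnorm, hπq]
  exact hz j k hjk
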